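/- Let $\mathbb{D}=\{z\in\mathbb{C}:|z|<1\}$ and let $c\in(0,2]$. Let $\mathcal{F}(c)$ be the class of analytic functions $f:\mathbb{D}\to\mathbb{C}$ with $f(0)=0$, $f'(0)=1$, $f'(z)\neq 0$ and $$\operatorname{Re}\left(1+\frac{zf''(z)}{f'(z)}\right)>1-\frac{c}{2}\qquad (z\in\mathbb{D}).$$ The logarithmic coefficients $\gamma_n=\gamma_n(f)$ are defined by $\log\frac{f(z)}{z}=2\sum_{n=1}^{\infty}\gamma_n z^n$ near the origin, where $f(z)/z$ is given the value $1$ at $z=0$ and the branch of the logarithm is the one vanishing at $z=0$. Put $$f_c(z)=\frac{(1-z)^{1-c}-1}{c-1}\quad(c\neq 1),\qquad f_1(z)=-\log(1-z),$$ with principal branches, and let $\psi(z)=\frac{zf_c'(z)}{f_c(z)}=1+\sum_{n=1}^{\infty}D_nz^n$ (with $\psi(0)=1$). All sums below are taken in $[0,\infty]$. Then every $f\in\mathcal{F}(c)$ satisfies $$\sum_{n=1}^{\infty}n^2|\gamma_n|^2\le\frac14\sum_{n=1}^{\infty}|D_n|^2$$ and, for every real $t\le 2$, $$\sum_{n=1}^{\infty}(n+1)^t|\gamma_n|^2\le\frac14\sum_{n=1}^{\infty}\frac{(n+1)^t}{n^2}|D_n|^2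 .$$ The first inequality is sharp: $f_c\in\mathcal{F}(c)$, and equality holds in it for $f=f_c$. -/

import Mathlib

noncomputable section

namespace LogCoeffs

/-- The open unit disk. -/
abbrev unitDisk : Set ℂ := Metric.ball 0 1

/-- The class `𝒜` of analytic functions on the unit disk with `f(0) = 0`, `f'(0) = 1`. -/
structure ClassA (f : ℂ → ℂ) : Prop where
  analytic : DifferentiableOn ℂ f unitDisk
  map_zero : f 0 = 0
  deriv_zero : deriv f 0 = 1

/-- The class `ℱ(c)`: functions of class `𝒜` such that `f'` has no zero in the unit disk and
`Re (1 + z f''(z) / f'(z)) > 1 - c / 2` there. -/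
structure ClassF (c : ℝ) (f : ℂ → ℂ) : Prop extends ClassA f where
  deriv_ne_zero : ∀ z ∈ unitDisk, deriv f z ≠ 0
  re_gt : ∀ z ∈ unitDisk, 1 - c / 2 < (1 + z * deriv (deriv f) z / deriv f z).re

/-- The `n`-th Taylor coefficient at the origin. -/
def taylorCoeff (g : ℂ → ℂ) (n : ℕ) : ℂ := iteratedDeriv n g 0 / (n.factorial : ℂ)

/-- The logarithmic coefficients `γ_n`, given by `log (f(z) / z) = 2 ∑ γ_n z ^ n`, where
`f(z) / z` takes the value `1` at the origin and the logarithm vanishes there. Taylor coefficients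
at the origin depend only on values near the origin, where this logarithm is the principal one. -/
def logCoeff (f : ℂ → ℂ) (n : ℕ) : ℂ :=
  taylorCoeff (fun z => Complex.log (if z = 0 then 1 else f z / z)) n / 2

/-- The function `f_c`. The power and the logarithm are the principal ones. -/
def extremal (c : ℝ) (z : ℂ) : ℂ :=
  if c = 1 then -Complex.log (1 - z)
  else ((1 - z) ^ (1 - (c : ℂ)) - 1) / ((c : ℂ) - 1)

/-- The function `ψ(z) = z f_c'(z) / f_c(z)`, with its removable singularity at the origin
filled in by the value `1`. -/
def psi (c : ℝ) (z : ℂ) : ℂ :=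
  if z = 0 then 1 else z * deriv (extremal c) z / extremal c z

end LogCoeffs

end

namespace LogCoeffs

open Filter Topology Metric Set Real

/-! Write `u = f / (z f')` and let `v` be the same quotient for `f_c`. Then `z u' = 1 - u P` with `P
= 1 + z f'' / f'`, and the defining condition of the class says that `P = 1 + c w / (1 - w)` with
`|w(z)| ≤ |z|`; for `f_c` one has `w(z) = z`. The core is the subordination `u = v ∘ ω`. Taking
reciprocals gives `z f' / f = ψ ∘ ω`.

Two facts about `v` make this work: it is univalent, and `-(1 - z)² v' / v` has positive real part.
The second says that `log v`, as a function of `s = 1 / (1 - z)` on the half-plane `Re s > 1/2`, has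
derivative of negative real part, which also gives the first. It holds because a multiple of this
expression again solves an equation `z y' = 1 - y P` with `Re P > 0`. If subordination failed,
Jack's lemma at a first exit point, together with the two differential equations, would equate a
number of nonnegative real part with one of negative real part.

Since `z f' / f = 1 + z (log (f / z))'`, its coefficients are `2 n γ_n`. Rogosinski's theorem bounds
the partial sums of `4 n² |γ_n|²` by those of `|D_n|²`, and Abel summation allows any nonnegative
decreasing weight: `1` for the first inequality, `(n + 1)^t / n²` for the second. -/

/-! ### First-contact arguments in the disk -/

/-- One-sided first order condition at a boundary point of a disk: if `Re g` is dominated inside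
the disk by `Re g z₀ + κ (‖z‖ / ‖z₀‖ - 1)`, then `z₀ g'(z₀)` is real and at least `κ`. -/
theorem im_eq_zero_and_le_re_of_forall_norm_lt {g : ℂ → ℂ} {g' z₀ : ℂ} {κ : ℝ} (hz₀ : z₀ ≠ 0)
    (hg : HasDerivAt g g' z₀)
    (hle : ∀ z, ‖z‖ < ‖z₀‖ → (g z).re ≤ (g z₀).re + κ * (‖z‖ / ‖z₀‖ - 1)) :
    (z₀ * g').im = 0 ∧ κ ≤ (z₀ * g').re := by
  -- The curve `z₀ exp (t v)` has modulus `|z₀| exp (t Re v)`, so it enters the disk for `t > 0`;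
  -- compare right derivatives of both sides of the hypothesis at `t = 0`.
  have key : ∀ v : ℂ, v.re < 0 → (z₀ * g' * v).re ≤ κ * v.re := by
    intro v hv
    have h1 : HasDerivAt (fun t : ℂ => z₀ * Complex.exp (t * v)) (z₀ * v) 0 := by
      have := (((hasDerivAt_id (0 : ℂ)).mul_const v).cexp).const_mul z₀
      simpa using this
    have h2 : HasDerivAt (fun t : ℂ => g (z₀ * Complex.exp (t * v))) (g' * (z₀ * v)) 0 := by
      have hg0 : HasDerivAt g g' (z₀ * Complex.exp (0 * v)) := by simpa using hg
      exact HasDerivAt.comp (0 : ℂ) hg0 h1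
    have h3 : HasDerivAt (fun t : ℝ => (g (z₀ * Complex.exp (t * v))).re) (g' * (z₀ * v)).re 0 := by
      have := HasDerivAt.real_of_complex (z := 0) (e := fun t : ℂ => g (z₀ * Complex.exp (t * v)))
        (e' := g' * (z₀ * v)) (by simpa using h2)
      simpa using this
    have h4 : HasDerivAt (fun t : ℝ => κ * Real.exp (t * v.re)) (κ * v.re) 0 := by
      have := (((hasDerivAt_id (0 : ℝ)).mul_const v.re).exp).const_mul κ
      simpa using this
    have h5 := (h3.sub h4).hasDerivWithinAt (s := Ioi 0)
    rw [hasDerivWithinAt_iff_tendsto_slope' (by simp)] at h5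
    have h6 : (g' * (z₀ * v)).re - κ * v.re ≤ 0 := by
      refine le_of_tendsto h5 ?_
      filter_upwards [self_mem_nhdsWithin] with t ht
      have ht' : (0 : ℝ) < t := ht
      rw [slope_def_field]
      have hn : ‖z₀ * Complex.exp (t * v)‖ = ‖z₀‖ * Real.exp (t * v.re) := by
        rw [norm_mul, Complex.norm_exp]; simp
      have hpos : 0 < ‖z₀‖ := norm_pos_iff.2 hz₀
      have hlt : Real.exp (t * v.re) < 1 := by
        rw [← Real.exp_zero]; exact Real.exp_lt_exp.2 (by nlinarith)
      have := hle (z₀ * Complex.exp (t * v)) (by rw [hn]; nlinarith)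
      rw [hn, mul_div_cancel_left₀ _ hpos.ne'] at this
      apply div_nonpos_of_nonpos_of_nonneg _ (by linarith)
      simp
      linarith
    have : z₀ * g' * v = g' * (z₀ * v) := by ring
    rw [this]; linarith
  -- The directions `v = -1 + i K` have fixed real part and arbitrary `K`, which forces the
  -- imaginary part to vanish.
  have key' : ∀ K : ℝ, -(z₀ * g').re - K * (z₀ * g').im ≤ -κ := by
    intro K
    have := key (-1 + K * Complex.I) (by simp)
    simp only [Complex.mul_re (z₀ * g')] at this
    simp at this
    simp
    linarith
  have him : (z₀ * g').im = 0 := by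
    by_contra h
    have := key' (-((z₀ * g').re - κ + 1) / (z₀ * g').im)
    rw [div_mul_cancel₀ _ h] at this
    linarith
  refine ⟨him, ?_⟩
  have := key' 0
  linarith

/-- A set whose trace on a closed disk is closed and nonempty has an element of minimal norm. -/
theorem exists_norm_minimal {C : Set ℂ} {r : ℝ} (hC : IsClosed (closedBall 0 r ∩ C))
    (hne : (closedBall 0 r ∩ C).Nonempty) :
    ∃ z₀ ∈ C, ‖z₀‖ ≤ r ∧ ∀ z, ‖z‖ < ‖z₀‖ → z ∉ C := by
  have hK : IsCompact (closedBall (0 : ℂ) r ∩ C) :=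
    (isCompact_closedBall (0 : ℂ) r).of_isClosed_subset hC inter_subset_left
  obtain ⟨z₀, hz₀, hmin⟩ := hK.exists_isMinOn hne continuous_norm.continuousOn
  have hr : ‖z₀‖ ≤ r := by simpa using hz₀.1
  refine ⟨z₀, hz₀.2, hr, fun z hz hzC => ?_⟩
  have : ‖z₀‖ ≤ ‖z‖ := hmin ⟨by simpa using (hz.le.trans hr), hzC⟩
  linarith

theorem mem_closure_ball_norm {z₀ : ℂ} (hz₀ : z₀ ≠ 0) : z₀ ∈ closure (ball (0 : ℂ) ‖z₀‖) := by
  rw [closure_ball _ (norm_ne_zero_iff.2 hz₀)]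
  simp

/-- Solutions of `z y' = 1 - y P` with `Re P > 0` have positive real part. -/
theorem re_pos_of_ode {y P : ℂ → ℂ} (hy : DifferentiableOn ℂ y unitDisk) (h0 : 0 < (y 0).re)
    (hP : ∀ z ∈ unitDisk, 0 < (P z).re)
    (hode : ∀ z ∈ unitDisk, z * deriv y z = 1 - y z * P z) :
    ∀ z ∈ unitDisk, 0 < (y z).re := by
  by_contra! hcon
  obtain ⟨z₁, hz₁, hyz₁⟩ := hcon
  have hz₁' : ‖z₁‖ < 1 := by simpa using hz₁
  have hsub : closedBall (0 : ℂ) ‖z₁‖ ⊆ unitDisk := closedBall_subset_ball hz₁'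
  have hre : ContinuousOn (fun z => (y z).re) unitDisk :=
    Complex.continuous_re.comp_continuousOn hy.continuousOn
  obtain ⟨z₀, hz₀C, hz₀r, hmin⟩ := exists_norm_minimal (C := {z | (y z).re ≤ 0}) (r := ‖z₁‖)
    ((hre.mono hsub).preimage_isClosed_of_isClosed isClosed_closedBall isClosed_Iic)
    ⟨z₁, by simp, hyz₁⟩
  have hz₀D : z₀ ∈ unitDisk := hsub (by simpa using hz₀r)
  have hz₀ : z₀ ≠ 0 := by rintro rfl; exact absurd hz₀C (by simpa using h0)
  have hyz₀ : (y z₀).re = 0 := by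
    refine le_antisymm hz₀C ?_
    have hc : ContinuousWithinAt (fun z => (y z).re) (ball 0 ‖z₀‖) z₀ :=
      (hre.continuousAt (isOpen_ball.mem_nhds hz₀D)).continuousWithinAt
    have := hc.mem_closure (mem_closure_ball_norm hz₀) (t := Ici 0)
      (fun z hz => (not_le.1 (hmin z (by simpa using hz))).le)
    simpa using this
  have hd : HasDerivAt y (deriv y z₀) z₀ :=
    (hy.differentiableAt (isOpen_ball.mem_nhds hz₀D)).hasDerivAt
  have ht := im_eq_zero_and_le_re_of_forall_norm_lt (κ := 0) hz₀ hd.neg (fun z hz => by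
    have := hmin z hz
    simp only [mem_ofPred_eq, not_le] at this
    simp [hyz₀, this.le])
  simp only [mul_neg, Complex.neg_im, Complex.neg_re] at ht
  -- Here `y z₀ = i b` and `z₀ y'(z₀)` is real and at most `0`. The imaginary part of `1 - i b P` is
  -- `-b Re P`, so `b = 0`, and then `z₀ y'(z₀) = 1`.
  have h1 := hode z₀ hz₀D
  have hpos := hP z₀ hz₀D
  rw [h1] at ht
  obtain ⟨hi, hr⟩ := ht
  simp [Complex.mul_re, Complex.mul_im, hyz₀] at hi hr
  rcases hi with hi | hi
  · rw [hi] at hr; norm_num at hr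
  · exact hpos.ne' hi

/-! ### Subordination -/

/-- An injective holomorphic function with nonvanishing derivative has a holomorphic inverse. -/
theorem exists_differentiable_inverse {v : ℂ → ℂ} {U : Set ℂ} (hU : IsOpen U)
    (hv : DifferentiableOn ℂ v U) (hinj : InjOn v U) (hne : ∀ z ∈ U, deriv v z ≠ 0) :
    ∃ G : ℂ → ℂ, ∀ z ∈ U, G (v z) = z ∧ HasDerivAt G (deriv v z)⁻¹ (v z) := by
  refine ⟨Function.invFunOn v U, fun z hz => ?_⟩
  have hleft : ∀ x ∈ U, Function.invFunOn v U (v x) = x := hinj.leftInvOn_invFunOn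
  refine ⟨hleft z hz, ?_⟩
  have hs : HasStrictDerivAt v (deriv v z) z :=
    (hv.analyticAt (hU.mem_nhds hz)).hasStrictDerivAt
  -- The global inverse agrees near `v z` with the local inverse, whose values stay in `U`, so it
  -- inherits the derivative.
  refine (hs.to_localInverse (hne z hz)).hasDerivAt.congr_of_eventuallyEq ?_
  have hc := (hs.to_localInverse (hne z hz)).hasDerivAt.continuousAt
  have hz' : hs.localInverse v _ z (hne z hz) (v z) = z :=
    (hs.hasStrictFDerivAt_equiv (hne z hz)).localInverse_apply_image
  have hmem := hc.eventually (p := fun x => x ∈ U) (by rw [hz']; exact hU.mem_nhds hz)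
  have hright := (hs.hasStrictFDerivAt_equiv (hne z hz)).eventually_right_inverse
  filter_upwards [hmem, hright] with x hx hx'
  conv_lhs => rw [← hx']
  exact hleft _ hx

theorem one_sub_ne_zero_of_norm_lt {x : ℂ} (hx : ‖x‖ < 1) : 1 - x ≠ 0 := by
  intro h
  rw [← sub_eq_zero.1 h] at hx
  simp at hx

theorem half_lt_re_inv_one_sub {x : ℂ} (hx : ‖x‖ < 1) : 1 / 2 < ((1 - x)⁻¹).re := by
  have hx1 := one_sub_ne_zero_of_norm_lt hx
  rw [Complex.inv_re, lt_div_iff₀ (Complex.normSq_pos.2 hx1), Complex.normSq_apply]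
  have : x.re * x.re + x.im * x.im < 1 := by
    rw [← Complex.normSq_apply, Complex.normSq_eq_norm_sq]; nlinarith [norm_nonneg x]
  simp
  nlinarith

/-- `Re (1 - a) (1 - b) / (1 - a b) > 0` in the unit bidisk. -/
theorem re_mul_div_pos {a b : ℂ} (ha : ‖a‖ < 1) (hb : ‖b‖ < 1) :
    0 < ((1 - a) * (1 - b) / (1 - a * b)).re := by
  have hab : 1 - a * b ≠ 0 := one_sub_ne_zero_of_norm_lt (by
    rw [norm_mul]; nlinarith [norm_nonneg a, norm_nonneg b])
  have ha1 := one_sub_ne_zero_of_norm_lt ha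
  have hb1 := one_sub_ne_zero_of_norm_lt hb
  have : (1 - a) * (1 - b) / (1 - a * b) = ((1 - a)⁻¹ + (1 - b)⁻¹ - 1)⁻¹ := by
    rw [← inv_inj, inv_inv, inv_div]
    field_simp
    ring
  rw [this, Complex.inv_re]
  have hre : 0 < ((1 - a)⁻¹ + (1 - b)⁻¹ - 1).re := by
    have h1 := half_lt_re_inv_one_sub ha
    have h2 := half_lt_re_inv_one_sub hb
    simp only [Complex.sub_re, Complex.add_re, Complex.one_re]
    linarith
  refine div_pos hre (Complex.normSq_pos.2 fun h => ?_)
  rw [h] at hre; simp at hre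

/-- Subordination for the differential equation `z u' = 1 - u (1 + c w / (1 - w))`. -/
theorem exists_subordination {c : ℝ} (hc : 0 < c) {u v w : ℂ → ℂ}
    (hu : DifferentiableOn ℂ u unitDisk) (hv : DifferentiableOn ℂ v unitDisk)
    (hu0 : u 0 = 1) (hv0 : v 0 = 1) (hinj : InjOn v unitDisk)
    (hre : ∀ z ∈ unitDisk, 0 < (-((1 - z) ^ 2 * deriv v z / v z)).re)
    (hw : ∀ z ∈ unitDisk, ‖w z‖ ≤ ‖z‖)
    (hodeu : ∀ z ∈ unitDisk, z * deriv u z = 1 - u z * (1 + c * w z / (1 - w z)))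
    (hodev : ∀ z ∈ unitDisk, z * deriv v z = 1 - v z * (1 + c * z / (1 - z))) :
    ∃ ω : ℂ → ℂ, DifferentiableOn ℂ ω unitDisk ∧ MapsTo ω unitDisk unitDisk ∧ ω 0 = 0 ∧
      ∀ z ∈ unitDisk, u z = v (ω z) := by
  have hdv : ∀ z ∈ unitDisk, deriv v z ≠ 0 := by
    intro z hz h
    have := hre z hz
    simp [h] at this
  have hvne : ∀ z ∈ unitDisk, v z ≠ 0 := by
    intro z hz h
    have := hre z hz
    simp [h] at this
  have h0D : (0 : ℂ) ∈ unitDisk := by simp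
  obtain ⟨G, hG⟩ := exists_differentiable_inverse isOpen_ball hv hinj hdv
  have hcomp : ∀ z ∈ unitDisk, ∀ ζ ∈ unitDisk, u z = v ζ →
      HasDerivAt (fun x => G (u x)) ((deriv v ζ)⁻¹ * deriv u z) z := by
    intro z hz ζ hζ h
    have h1 := (hG ζ hζ).2
    rw [← h] at h1
    exact h1.comp z (hu.differentiableAt (isOpen_ball.mem_nhds hz)).hasDerivAt
  have hopen : ∀ ρ : ℝ, ρ ≤ 1 → IsOpen (v '' ball 0 ρ) := by
    intro ρ hρ
    rw [isOpen_iff_mem_nhds]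
    rintro _ ⟨z, hz, rfl⟩
    have hzD : z ∈ unitDisk := ball_subset_ball hρ hz
    have hs : HasStrictDerivAt v (deriv v z) z :=
      (hv.analyticAt (isOpen_ball.mem_nhds hzD)).hasStrictDerivAt
    rw [← hs.map_nhds_eq (hdv z hzD)]
    exact image_mem_map (isOpen_ball.mem_nhds hz)
  have hmaps : ∀ z ∈ unitDisk, u z ∈ v '' unitDisk := by
    by_contra! hcon
    obtain ⟨z₁, hz₁, hu₁⟩ := hcon
    have hz₁' : ‖z₁‖ < 1 := by simpa using hz₁
    -- Taking `ρ > |z₁|` makes `|w z₀| ≤ |z₀| ≤ |z₁| < ρ = |ζ|` strict below, so that `w z₀ / ζ`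
    -- lies in the open disk.
    obtain ⟨ρ, hρ1, hρ2⟩ := exists_between hz₁'
    have hsub : closedBall (0 : ℂ) ‖z₁‖ ⊆ unitDisk := closedBall_subset_ball hz₁'
    obtain ⟨z₀, hz₀C, hz₀r, hmin⟩ :=
      exists_norm_minimal (C := {z | u z ∈ (v '' ball 0 ρ)ᶜ}) (r := ‖z₁‖)
      ((hu.continuousOn.mono hsub).preimage_isClosed_of_isClosed isClosed_closedBall
        (hopen ρ hρ2.le).isClosed_compl)
      ⟨z₁, by simp, fun h => hu₁ (image_mono (ball_subset_ball hρ2.le) h)⟩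
    have hρ0 : 0 < ρ := (norm_nonneg _).trans_lt hρ1
    have hz₀D : z₀ ∈ unitDisk := hsub (by simpa using hz₀r)
    have hz₀ : z₀ ≠ 0 := by
      rintro rfl
      exact hz₀C ⟨0, by simpa using hρ0, by rw [hu0, hv0]⟩
    have hρD : closedBall (0 : ℂ) ρ ⊆ unitDisk := closedBall_subset_ball hρ2
    have hcl : u z₀ ∈ v '' closedBall 0 ρ := by
      have hcw : ContinuousWithinAt u (ball 0 ‖z₀‖) z₀ :=
        (hu.continuousOn.continuousAt (isOpen_ball.mem_nhds hz₀D)).continuousWithinAt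
      have hcc : IsClosed (v '' closedBall 0 ρ) :=
        ((isCompact_closedBall (0 : ℂ) ρ).image_of_continuousOn
          (hv.continuousOn.mono hρD)).isClosed
      have := hcw.mem_closure (mem_closure_ball_norm hz₀) (t := v '' closedBall 0 ρ)
        (fun z hz => by
          have := hmin z (by simpa using hz)
          simp only [mem_ofPred_eq, mem_compl_iff, not_not] at this
          exact image_mono ball_subset_closedBall this)
      rwa [hcc.closure_eq] at this
    obtain ⟨ζ, hζ, hζu⟩ := hcl
    have hζD := hρD hζ
    have hζn : ‖ζ‖ = ρ := by
      refine le_antisymm (by simpa using hζ) ?_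
      by_contra! h
      exact hz₀C ⟨ζ, by simpa using h, hζu⟩
    have hζ0 : ζ ≠ 0 := norm_pos_iff.1 (by rw [hζn]; exact hρ0)
    have hz₀pos : 0 < ‖z₀‖ := norm_pos_iff.2 hz₀
    set ω : ℂ → ℂ := fun x => G (u x) with hω
    have hωin : ∀ z, ‖z‖ < ‖z₀‖ → ∃ ξ, ‖ξ‖ < ρ ∧ u z = v ξ ∧ ω z = ξ := by
      intro z hz
      have := hmin z hz
      simp only [mem_ofPred_eq, mem_compl_iff, not_not] at this
      obtain ⟨ξ, hξ, hξu⟩ := this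
      have hξρ : ‖ξ‖ < ρ := by simpa using hξ
      refine ⟨ξ, hξρ, hξu.symm, ?_⟩
      simp only [hω]
      rw [← hξu]
      exact (hG ξ (by simpa using hξρ.trans hρ2)).1
    have hω0 : ω 0 = 0 := by simp only [hω]; rw [hu0, ← hv0]; exact (hG 0 h0D).1
    have hschwarz : ∀ z, ‖z‖ < ‖z₀‖ → ‖ω z‖ ≤ ρ / ‖z₀‖ * ‖z‖ := by
      intro z hz
      have hd : DifferentiableOn ℂ ω (ball 0 ‖z₀‖) := by
        intro x hx
        have hx' : ‖x‖ < ‖z₀‖ := by simpa using hx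
        obtain ⟨ξ, hξ, hξu, -⟩ := hωin x hx'
        exact (hcomp x (by simpa using hx'.trans_le (hz₀r.trans hz₁'.le)) ξ
          (by simpa using hξ.trans hρ2) hξu).differentiableAt.differentiableWithinAt
      have := Complex.dist_le_div_mul_dist_of_mapsTo_ball (R₂ := ρ) hd (fun x hx => by
        obtain ⟨ξ, hξ, -, hξω⟩ := hωin x (by simpa using hx)
        rw [hω0, hξω]; simpa using hξ.le) (z := z) (by simpa using hz)
      simpa [hω0] using this
    have hωz₀ : ω z₀ = ζ := by simp only [hω]; rw [← hζu]; exact (hG ζ hζD).1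
    have hd := (hcomp z₀ hz₀D ζ hζD hζu.symm).div_const ζ
    -- Jack's lemma: by Schwarz, `|ω z / ζ| ≤ |z| / |z₀|`, with value `1` at `z₀`, so `m = z₀ ω'(z₀)
    -- / ζ` is real and at least `1`.
    have ht := im_eq_zero_and_le_re_of_forall_norm_lt (κ := 1) hz₀ hd (fun z hz => by
      have h1 : (ω z / ζ).re ≤ ‖z‖ / ‖z₀‖ := by
        refine (Complex.re_le_norm _).trans ?_
        rw [norm_div, hζn, div_le_iff₀ hρ0]
        refine (hschwarz z hz).trans (le_of_eq ?_)
        ring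
      have h2 : (ω z₀ / ζ).re = 1 := by rw [hωz₀, div_self hζ0]; simp
      change (ω z / ζ).re ≤ (ω z₀ / ζ).re + 1 * (‖z‖ / ‖z₀‖ - 1)
      linarith)
    set m : ℂ := z₀ * ((deriv v ζ)⁻¹ * deriv u z₀ / ζ) with hm
    have hmreal : m = (m.re : ℂ) := by
      apply Complex.ext <;> simp [ht.1]
    have hmu : z₀ * deriv u z₀ = m * (ζ * deriv v ζ) := by
      rw [hm]; field_simp [hdv ζ hζD]
    have e1 := hodeu z₀ hz₀D
    have e2 := hodev ζ hζD
    have hw₀ : ‖w z₀‖ < ‖ζ‖ := (hw z₀ hz₀D).trans_lt (hz₀r.trans_lt (hζn ▸ hρ1))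
    have hζ1 : ‖ζ‖ < 1 := by simpa using hζD
    have n1 := one_sub_ne_zero_of_norm_lt hζ1
    have n2 := one_sub_ne_zero_of_norm_lt (hw₀.trans hζ1)
    have n3 := hvne ζ hζD
    rw [hmu, ← hζu] at e1
    -- The difference of the two differential equations, at `z₀` and at `ζ`. The left side has real
    -- part at least `0` since `m ≥ 1`; the right side is `-c` times a number of positive real part.
    have e3 : (m - 1) * (-((1 - ζ) ^ 2 * deriv v ζ / v ζ)) =
        -(c * ((1 - ζ) * (1 - w z₀ / ζ) / (1 - ζ * (w z₀ / ζ)))) := by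
      have e4 : (m - 1) * (ζ * deriv v ζ) =
          v ζ * (c * (ζ - w z₀) / ((1 - ζ) * (1 - w z₀))) := by
        have : c * (ζ - w z₀) / ((1 - ζ) * (1 - w z₀)) =
          (1 + c * ζ / (1 - ζ)) - (1 + c * w z₀ / (1 - w z₀)) := by field_simp; ring
        rw [this]
        linear_combination e1 - e2
      have e5 : deriv v ζ * (m - 1) =
          v ζ * (c * (ζ - w z₀) / ((1 - ζ) * (1 - w z₀))) / ζ := by
        rw [← e4]; field_simp
      have e6 : (m - 1) * (-((1 - ζ) ^ 2 * deriv v ζ / v ζ)) =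
        -((1 - ζ) ^ 2 / v ζ * (deriv v ζ * (m - 1))) := by ring
      rw [e6, e5, mul_div_cancel₀ _ hζ0]
      field_simp
    have hp := re_mul_div_pos hζ1 (b := w z₀ / ζ)
      (by rw [norm_div, div_lt_one (norm_pos_iff.2 hζ0)]; exact hw₀)
    have hl := hre ζ hζD
    have e7 := congrArg Complex.re e3
    have e8 : m - 1 = ((m.re - 1 : ℝ) : ℂ) := by rw [hmreal]; simp
    rw [e8, Complex.re_ofReal_mul, Complex.neg_re (c * _), Complex.re_ofReal_mul] at e7
    have : 0 ≤ (m.re - 1) * (-((1 - ζ) ^ 2 * deriv v ζ / v ζ)).re :=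
      mul_nonneg (by linarith [ht.2]) hl.le
    have := mul_pos hc hp
    linarith
  refine ⟨fun x => G (u x), fun z hz => ?_, fun z hz => ?_, ?_, fun z hz => ?_⟩
  · obtain ⟨ζ, hζ, h⟩ := hmaps z hz
    exact (hcomp z hz ζ hζ h.symm).differentiableAt.differentiableWithinAt
  · obtain ⟨ζ, hζ, h⟩ := hmaps z hz
    simp only
    rw [← h, (hG ζ hζ).1]
    exact hζ
  · simp only
    rw [hu0, ← hv0]; exact (hG 0 h0D).1
  · obtain ⟨ζ, hζ, h⟩ := hmaps z hz
    simp only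
    rw [← h, (hG ζ hζ).1]

/-! ### The quotient `f / (z f')` on the class `ℱ(c)` -/

/-- The function `f(z) / (z f'(z))`, with its removable singularity filled in. -/
noncomputable def starRatio (f : ℂ → ℂ) (z : ℂ) : ℂ := dslope f 0 z / deriv f z

theorem unitDisk_mem_nhds {z : ℂ} (hz : z ∈ unitDisk) : unitDisk ∈ 𝓝 z := isOpen_ball.mem_nhds hz

theorem zero_mem_unitDisk : (0 : ℂ) ∈ unitDisk := by simp

theorem differentiableOn_dslope_unitDisk {f : ℂ → ℂ} (hf : DifferentiableOn ℂ f unitDisk) :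
    DifferentiableOn ℂ (dslope f 0) unitDisk :=
  (Complex.differentiableOn_dslope (unitDisk_mem_nhds zero_mem_unitDisk)).2 hf

theorem mul_dslope_zero (f : ℂ → ℂ) (z : ℂ) : z * dslope f 0 z = f z - f 0 := by
  simpa using sub_smul_dslope f 0 z

namespace ClassF

variable {c : ℝ} {f : ℂ → ℂ}

theorem dslope_add_mul_deriv_dslope (hf : ClassF c f) {z : ℂ} (hz : z ∈ unitDisk) :
    dslope f 0 z + z * deriv (dslope f 0) z = deriv f z := by
  have h := (hasDerivAt_id z).mul ((differentiableOn_dslope_unitDisk hf.analytic).differentiableAt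
    (unitDisk_mem_nhds hz)).hasDerivAt
  have h' : (id * dslope f 0) = f := by
    funext x; simp [mul_dslope_zero, hf.map_zero]
  rw [h'] at h
  simpa using h.deriv.symm

theorem differentiableOn_starRatio (hf : ClassF c f) :
    DifferentiableOn ℂ (starRatio f) unitDisk :=
  (differentiableOn_dslope_unitDisk hf.analytic).div (hf.analytic.deriv isOpen_ball)
    hf.deriv_ne_zero

theorem starRatio_zero (hf : ClassF c f) : starRatio f 0 = 1 := by
  simp [starRatio, hf.deriv_zero]

/-- This is the reason for working with `f / (z f')`: its equation is linear, whereas `z f' / f`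
satisfies a Riccati equation. -/
theorem mul_deriv_starRatio (hf : ClassF c f) {z : ℂ} (hz : z ∈ unitDisk) :
    z * deriv (starRatio f) z =
      1 - starRatio f z * (1 + z * deriv (deriv f) z / deriv f z) := by
  have hg := ((differentiableOn_dslope_unitDisk hf.analytic).differentiableAt
    (unitDisk_mem_nhds hz)).hasDerivAt
  have hf' := ((hf.analytic.deriv isOpen_ball).differentiableAt (unitDisk_mem_nhds hz)).hasDerivAt
  have hne := hf.deriv_ne_zero z hz
  have h1 : deriv (starRatio f) z = (deriv (dslope f 0) z * deriv f z -
      dslope f 0 z * deriv (deriv f) z) / deriv f z ^ 2 := (hg.div hf' hne).deriv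
  have h2 := hf.dslope_add_mul_deriv_dslope hz
  rw [h1, starRatio]
  field_simp
  linear_combination h2 * deriv f z

/-- The bound `c ≤ 2` enters here: it makes `Re (1 + z f'' / f') > 1 - c / 2 ≥ 0`. -/
theorem re_starRatio_pos (hf : ClassF c f) (hc : c ≤ 2) :
    ∀ z ∈ unitDisk, 0 < (starRatio f z).re :=
  re_pos_of_ode hf.differentiableOn_starRatio (by simp [hf.starRatio_zero])
    (fun z hz => by have := hf.re_gt z hz; linarith) (fun _ hz => hf.mul_deriv_starRatio hz)

theorem starRatio_ne_zero (hf : ClassF c f) (hc : c ≤ 2) {z : ℂ} (hz : z ∈ unitDisk) :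
    starRatio f z ≠ 0 := by
  intro h
  have := hf.re_starRatio_pos hc z hz
  simp [h] at this

theorem inv_starRatio_of_ne_zero (hf : ClassF c f) {z : ℂ} (hz0 : z ≠ 0) :
    (starRatio f z)⁻¹ = z * deriv f z / f z := by
  have h := mul_dslope_zero f z
  rw [hf.map_zero, sub_zero] at h
  rw [starRatio, ← h, inv_div, mul_div_mul_left _ _ hz0]

/-- The convexity functional of a function of class `ℱ(c)` is `1 + c w / (1 - w)` for a Schwarz
function `w`. -/
theorem exists_schwarz (hf : ClassF c f) (hc : 0 < c) :
    ∃ w : ℂ → ℂ, (∀ z ∈ unitDisk, ‖w z‖ ≤ ‖z‖) ∧ ∀ z ∈ unitDisk,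
      1 + z * deriv (deriv f) z / deriv f z = 1 + c * w z / (1 - w z) := by
  set X : ℂ → ℂ := fun z => z * deriv (deriv f) z / deriv f z with hX
  have hXre : ∀ z ∈ unitDisk, -(c / 2) < (X z).re := by
    intro z hz
    have := hf.re_gt z hz
    rw [Complex.add_re, Complex.one_re] at this
    simp only [hX]; linarith
  have hXc : ∀ z ∈ unitDisk, X z + c ≠ 0 := by
    intro z hz h
    have h1 := congrArg Complex.re h
    have := hXre z hz
    simp at h1
    linarith
  have hdX : DifferentiableOn ℂ X unitDisk :=
    (differentiableOn_id.mul ((hf.analytic.deriv isOpen_ball).deriv isOpen_ball)).div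
      (hf.analytic.deriv isOpen_ball) hf.deriv_ne_zero
  -- Solve `X = c w / (1 - w)` for `w`; `|X| ≤ |X + c|` amounts to `Re X ≥ -c / 2`, and `X 0 = 0`
  -- lets the Schwarz lemma apply.
  refine ⟨fun z => X z / (X z + c), fun z hz => ?_, fun z hz => ?_⟩
  · refine Complex.norm_le_norm_of_mapsTo_ball (R := 1) (f := fun z => X z / (X z + c))
      (hdX.div (hdX.add_const _) hXc) (fun x hx => ?_) ?_ (by simpa using hz)
    · rw [mem_closedBall_zero_iff, norm_div, div_le_one (norm_pos_iff.2 (hXc x hx))]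
      refine le_of_sq_le_sq ?_ (norm_nonneg _)
      rw [← Complex.normSq_eq_norm_sq, ← Complex.normSq_eq_norm_sq, Complex.normSq_apply,
        Complex.normSq_apply]
      have := hXre x hx
      simp
      nlinarith
    · simp [hX]
  · have h1 := hXc z hz
    have h2 : (c : ℂ) ≠ 0 := by exact_mod_cast hc.ne'
    have h3 : 1 - X z / (X z + c) = c / (X z + c) := by
      rw [one_sub_div h1, add_sub_cancel_left]
    change 1 + X z = 1 + c * (X z / (X z + c)) / (1 - X z / (X z + c))
    rw [h3]
    field_simp

end ClassF

/-! ### Univalence of the dominant solution -/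

/-- A holomorphic function on a convex set whose derivative has negative real part is injective. -/
theorem injOn_of_re_deriv_neg {l l' : ℂ → ℂ} {H : Set ℂ} (hH : Convex ℝ H)
    (hl : ∀ s ∈ H, HasDerivAt l (l' s) s) (hneg : ∀ s ∈ H, (l' s).re < 0) : InjOn l H := by
  intro a ha b hb hab
  by_contra hne
  set d := b - a with hd
  have hd0 : d ≠ 0 := sub_ne_zero.2 (Ne.symm hne)
  have hmem : ∀ t ∈ Icc (0 : ℝ) 1, a + t * d ∈ H := by
    intro t ht
    have := hH.add_smul_sub_mem ha hb ht
    simpa [hd] using this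
  -- Along the segment from `a` to `b`, `Re (conj d · l)` has derivative `|d|² Re l' < 0`, so its
  -- endpoint values differ.
  set φ : ℝ → ℝ := fun t => (starRingEnd ℂ d * l (a + t * d)).re with hφ
  have hder : ∀ t ∈ Icc (0 : ℝ) 1, HasDerivAt φ (Complex.normSq d * (l' (a + t * d)).re) t := by
    intro t ht
    have h1 : HasDerivAt (fun x : ℂ => a + x * d) d (t : ℂ) := by
      simpa using ((hasDerivAt_id (t : ℂ)).mul_const d).const_add a
    have h2 := (HasDerivAt.comp (t : ℂ) (hl _ (hmem t ht)) h1).const_mul (starRingEnd ℂ d)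
    refine HasDerivAt.congr_deriv h2.real_of_complex ?_
    rw [← Complex.re_ofReal_mul, ← Complex.mul_conj]
    congr 1
    ring
  have hanti : StrictAntiOn φ (Icc 0 1) := by
    refine strictAntiOn_of_deriv_neg (convex_Icc 0 1)
      (fun t ht => (hder t ht).continuousAt.continuousWithinAt) (fun t ht => ?_)
    have ht' := interior_subset ht
    rw [(hder t ht').deriv]
    exact mul_neg_of_pos_of_neg (Complex.normSq_pos.2 hd0) (hneg _ (hmem t ht'))
  have := hanti (left_mem_Icc.2 zero_le_one) (right_mem_Icc.2 zero_le_one) zero_lt_one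
  simp [hφ, hd, hab] at this

/-- A solution of `z v' = 1 - v (1 + c z / (1 - z))` is such that `log v` has a derivative of
negative real part with respect to `1 / (1 - z)`. -/
theorem re_neg_log_deriv_pos {c : ℝ} (hc : 0 < c) {v : ℂ → ℂ}
    (hv : DifferentiableOn ℂ v unitDisk) (hv0 : v 0 = 1) (hvpos : ∀ z ∈ unitDisk, 0 < (v z).re)
    (hode : ∀ z ∈ unitDisk, z * deriv v z = 1 - v z * (1 + c * z / (1 - z))) :
    ∀ z ∈ unitDisk, 0 < (-((1 - z) ^ 2 * deriv v z / v z)).re := by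
  have hc0 : (c : ℂ) ≠ 0 := by exact_mod_cast hc.ne'
  have hvne : ∀ z ∈ unitDisk, v z ≠ 0 := by
    intro z hz h
    have := hvpos z hz
    simp [h] at this
  have hdv := hv.deriv isOpen_ball
  have hode' : ∀ z ∈ unitDisk, deriv v z + z * deriv (deriv v) z =
      -(deriv v z * (1 + c * z / (1 - z)) + v z * (c / (1 - z) ^ 2)) := by
    intro z hz
    have hz1 := one_sub_ne_zero_of_norm_lt (x := z) (by simpa using hz)
    have h1 := (hasDerivAt_id z).mul
      (hdv.differentiableAt (unitDisk_mem_nhds hz)).hasDerivAt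
    have h2 : HasDerivAt (fun z : ℂ => 1 + c * z / (1 - z)) (c / (1 - z) ^ 2) z := by
      have := ((((hasDerivAt_id z).const_mul (c : ℂ)).div ((hasDerivAt_id z).const_sub 1)
        hz1).const_add 1)
      refine HasDerivAt.congr_deriv this ?_
      simp; ring
    have h3 := (((hv.differentiableAt (unitDisk_mem_nhds hz)).hasDerivAt.mul h2).const_sub 1)
    have h4 := h1.congr_of_eventuallyEq (f₁ := fun z => 1 - v z * (1 + c * z / (1 - z)))
      (by filter_upwards [unitDisk_mem_nhds hz] with x hx; exact (hode x hx).symm)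
    have := h4.unique h3
    simpa using this
  -- Division by `c` normalizes the equation to `z y' = 1 - y P` with `P = (1 + z) / (1 - z) + 1 /
  -- v`, whose real part is positive because `Re v > 0`.
  set y : ℂ → ℂ := fun z => -((1 - z) ^ 2 * deriv v z / v z) / c with hy
  have hydiff : DifferentiableOn ℂ y unitDisk :=
    (((((differentiableOn_const 1).sub differentiableOn_id).pow 2).mul hdv).div hv
      hvne).neg.div_const _
  have hy0 : y 0 = 1 / 2 := by
    have h := hode' 0 zero_mem_unitDisk
    simp [hv0] at h
    have : deriv v 0 = -c / 2 := by linear_combination h / 2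
    simp only [hy, hv0, this]
    field_simp
    simp
  have hpos := re_pos_of_ode (y := y) (P := fun z => (1 + z) / (1 - z) + (v z)⁻¹) hydiff
    (by rw [hy0]; norm_num) (fun z hz => ?_) (fun z hz => ?_)
  · intro z hz
    have h1 := hpos z hz
    have h2 : -((1 - z) ^ 2 * deriv v z / v z) = c * y z := by
      simp only [hy]; field_simp
    rw [h2, Complex.re_ofReal_mul]
    exact mul_pos hc h1
  · have hz' : ‖z‖ < 1 := by simpa using hz
    have h1 := half_lt_re_inv_one_sub hz'
    have h2 : (1 + z) / (1 - z) = 2 * (1 - z)⁻¹ - 1 := by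
      have := one_sub_ne_zero_of_norm_lt hz'
      field_simp; ring
    have h3 : 0 < ((v z)⁻¹).re := by
      rw [Complex.inv_re]
      exact div_pos (hvpos z hz) (Complex.normSq_pos.2 (hvne z hz))
    rw [Complex.add_re, h2]
    simp only [Complex.sub_re, Complex.mul_re, Complex.re_ofNat, Complex.im_ofNat,
      Complex.one_re]
    linarith
  · have hz' : ‖z‖ < 1 := by simpa using hz
    have n1 := one_sub_ne_zero_of_norm_lt hz'
    have n2 := hvne z hz
    have h1 : HasDerivAt y (-(((2 * (1 - z) * (-1)) * deriv v z + (1 - z) ^ 2 *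
        deriv (deriv v) z) * v z - (1 - z) ^ 2 * deriv v z * deriv v z) / v z ^ 2 / c) z := by
      have e1 : HasDerivAt (fun z : ℂ => (1 - z) ^ 2) (2 * (1 - z) * (-1)) z := by
        refine HasDerivAt.congr_deriv (((hasDerivAt_id z).const_sub 1).pow 2) ?_
        simp
      refine HasDerivAt.congr_deriv (((e1.mul
        (hdv.differentiableAt (unitDisk_mem_nhds hz)).hasDerivAt).div
        (hv.differentiableAt (unitDisk_mem_nhds hz)).hasDerivAt n2).neg.div_const (c : ℂ)) ?_
      simp only [Pi.mul_apply]; ring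
    have a1 := hode z hz
    have a2 := hode' z hz
    have b1 : z * deriv v z * (1 - z) = (1 - z) - v z * (1 - z + c * z) := by
      rw [a1]; field_simp
    have b2 : (1 - z) ^ 2 * (z * deriv (deriv v) z) = -((1 - z) ^ 2 * deriv v z) -
        (deriv v z * (1 - z) * (1 - z + c * z) + v z * c) := by
      rw [eq_sub_of_add_eq' a2]; field_simp; ring
    rw [h1.deriv]
    simp only [hy]
    field_simp
    linear_combination (-(v z)) * b2 + (1 - z) * deriv v z * b1

/-- A function `v` as in `re_neg_log_deriv_pos` is injective. -/
theorem injOn_of_re_neg_log_deriv_pos {v : ℂ → ℂ}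
    (hv : DifferentiableOn ℂ v unitDisk) (hvpos : ∀ z ∈ unitDisk, 0 < (v z).re)
    (hre : ∀ z ∈ unitDisk, 0 < (-((1 - z) ^ 2 * deriv v z / v z)).re) :
    InjOn v unitDisk := by
  -- The image of the disk under `s = 1 / (1 - z)`, where `dz/ds = (1 - z)²`. The principal
  -- logarithm of `v` is holomorphic since `Re v > 0`.
  set H : Set ℂ := {s | 1 / 2 < s.re} with hH
  have hmem : ∀ s ∈ H, s ≠ 0 ∧ 1 - s⁻¹ ∈ unitDisk := by
    intro s hs
    have hs' : 1 / 2 < s.re := hs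
    have hs0 : s ≠ 0 := by rintro rfl; norm_num at hs'
    refine ⟨hs0, ?_⟩
    have : 1 - s⁻¹ = (s - 1) / s := by field_simp
    rw [this, mem_ball_zero_iff, norm_div, div_lt_one (norm_pos_iff.2 hs0)]
    refine lt_of_pow_lt_pow_left₀ 2 (norm_nonneg _) ?_
    rw [← Complex.normSq_eq_norm_sq, ← Complex.normSq_eq_norm_sq, Complex.normSq_apply,
      Complex.normSq_apply]
    simp
    nlinarith
  have hinj := injOn_of_re_deriv_neg (l := fun s => Complex.log (v (1 - s⁻¹)))
    (l' := fun s => (s ^ 2)⁻¹ * deriv v (1 - s⁻¹) / v (1 - s⁻¹)) (H := H)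
    (convex_halfSpace_re_gt _) (fun s hs => ?_) (fun s hs => ?_)
  · intro a ha b hb hab
    have key : ∀ x ∈ unitDisk, (1 - x)⁻¹ ∈ H ∧ 1 - ((1 - x)⁻¹)⁻¹ = x := by
      intro x hx
      exact ⟨half_lt_re_inv_one_sub (by simpa using hx), by simp⟩
    have h1 := hinj (key a ha).1 (key b hb).1 (by simp only [(key a ha).2, (key b hb).2, hab])
    simpa using h1
  · obtain ⟨hs0, hsD⟩ := hmem s hs
    have h1 : HasDerivAt (fun s : ℂ => 1 - s⁻¹) ((s ^ 2)⁻¹) s := by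
      simpa using (hasDerivAt_inv hs0).const_sub 1
    have h2 := (hv.differentiableAt (unitDisk_mem_nhds hsD)).hasDerivAt.comp s h1
    refine HasDerivAt.congr_deriv (h2.clog (Or.inl (hvpos _ hsD))) ?_
    simp only [Function.comp_apply]; ring
  · obtain ⟨hs0, hsD⟩ := hmem s hs
    have := hre _ hsD
    simp only [sub_sub_cancel, Complex.neg_re] at this
    rw [← inv_pow]
    linarith

/-! ### The extremal function and subordination to `ψ` -/

theorem hasDerivAt_extremal (c : ℝ) {z : ℂ} (hz : z ∈ unitDisk) :
    HasDerivAt (extremal c) ((1 - z) ^ (-(c : ℂ))) z := by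
  have hz' : ‖z‖ < 1 := by simpa using hz
  have hslit : 1 - z ∈ Complex.slitPlane := by
    left
    have := (Complex.re_le_norm z).trans_lt hz'
    simp; linarith
  have hne := one_sub_ne_zero_of_norm_lt hz'
  have h1 : HasDerivAt (fun x : ℂ => 1 - x) (-1) z := by
    simpa using (hasDerivAt_id z).const_sub 1
  by_cases hc : c = 1
  · have he : extremal c = fun z => -Complex.log (1 - z) := by
      funext x; simp [extremal, hc]
    rw [he]
    refine HasDerivAt.congr_deriv (h1.clog hslit).neg ?_
    rw [hc, Complex.ofReal_one, Complex.cpow_neg_one]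
    field_simp
  · have he : extremal c = fun z => ((1 - z) ^ (1 - (c : ℂ)) - 1) / ((c : ℂ) - 1) := by
      funext x; simp [extremal, hc]
    have hc' : (c : ℂ) - 1 ≠ 0 := by
      rw [sub_ne_zero]; exact_mod_cast hc
    rw [he]
    refine HasDerivAt.congr_deriv
      (((h1.cpow_const (c := 1 - (c : ℂ)) hslit).sub_const 1).div_const ((c : ℂ) - 1)) ?_
    have : (1 - (c : ℂ)) - 1 = -c := by ring
    rw [this]
    field_simp
    ring

theorem hasDerivAt_one_sub_cpow (c : ℝ) {z : ℂ} (hz : z ∈ unitDisk) :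
    HasDerivAt (fun z : ℂ => (1 - z) ^ (-(c : ℂ))) (c * (1 - z) ^ (-(c : ℂ)) / (1 - z)) z := by
  have hz' : ‖z‖ < 1 := by simpa using hz
  have hslit : 1 - z ∈ Complex.slitPlane := by
    left
    have := (Complex.re_le_norm z).trans_lt hz'
    simp; linarith
  have hne := one_sub_ne_zero_of_norm_lt hz'
  have h1 : HasDerivAt (fun x : ℂ => 1 - x) (-1) z := by
    simpa using (hasDerivAt_id z).const_sub 1
  refine HasDerivAt.congr_deriv (h1.cpow_const (c := -(c : ℂ)) hslit) ?_
  rw [Complex.cpow_sub _ _ hne, Complex.cpow_one]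
  ring

theorem mul_deriv_deriv_extremal_div (c : ℝ) {z : ℂ} (hz : z ∈ unitDisk) :
    z * deriv (deriv (extremal c)) z / deriv (extremal c) z = c * z / (1 - z) := by
  have hz' : ‖z‖ < 1 := by simpa using hz
  have hne := one_sub_ne_zero_of_norm_lt hz'
  have h1 : deriv (extremal c) =ᶠ[𝓝 z] fun z => (1 - z) ^ (-(c : ℂ)) := by
    filter_upwards [unitDisk_mem_nhds hz] with x hx using (hasDerivAt_extremal c hx).deriv
  rw [h1.deriv_eq, h1.self_of_nhds, (hasDerivAt_one_sub_cpow c hz).deriv]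
  have h2 : (1 - z) ^ (-(c : ℂ)) ≠ 0 := by simp [Complex.cpow_eq_zero_iff, hne]
  field_simp

theorem classF_extremal {c : ℝ} (hc : 0 < c) : ClassF c (extremal c) where
  analytic := fun _ hz => (hasDerivAt_extremal c hz).differentiableAt.differentiableWithinAt
  map_zero := by unfold extremal; split_ifs <;> simp
  deriv_zero := by rw [(hasDerivAt_extremal c zero_mem_unitDisk).deriv]; simp
  deriv_ne_zero := fun z hz => by
    have hne := one_sub_ne_zero_of_norm_lt (x := z) (by simpa using hz)
    rw [(hasDerivAt_extremal c hz).deriv]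
    simp [Complex.cpow_eq_zero_iff, hne]
  re_gt := fun z hz => by
    have hz' : ‖z‖ < 1 := by simpa using hz
    have hne := one_sub_ne_zero_of_norm_lt hz'
    rw [mul_deriv_deriv_extremal_div c hz]
    have h1 : (c : ℂ) * z / (1 - z) = c * ((1 - z)⁻¹ - 1) := by field_simp; ring
    have h2 := half_lt_re_inv_one_sub hz'
    rw [h1, Complex.add_re, Complex.re_ofReal_mul, Complex.sub_re]
    simp only [Complex.one_re]
    nlinarith

theorem psi_eq_inv_starRatio {c : ℝ} (hc : 0 < c) (z : ℂ) :
    psi c z = (starRatio (extremal c) z)⁻¹ := by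
  unfold psi
  split_ifs with h
  · rw [h, (classF_extremal hc).starRatio_zero, inv_one]
  · rw [(classF_extremal hc).inv_starRatio_of_ne_zero h]

/-- For `f` in `ℱ(c)`, the function `z f'(z) / f(z)` is subordinate to `ψ`. -/
theorem ClassF.exists_inv_starRatio_eq_psi_comp {c : ℝ} (hc : 0 < c) (hc2 : c ≤ 2) {f : ℂ → ℂ}
    (hf : ClassF c f) :
    ∃ ω : ℂ → ℂ, DifferentiableOn ℂ ω unitDisk ∧ MapsTo ω unitDisk unitDisk ∧ ω 0 = 0 ∧
      ∀ z ∈ unitDisk, (starRatio f z)⁻¹ = psi c (ω z) := by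
  have he := classF_extremal hc
  have hode : ∀ z ∈ unitDisk, z * deriv (starRatio (extremal c)) z =
      1 - starRatio (extremal c) z * (1 + c * z / (1 - z)) := fun z hz => by
    rw [he.mul_deriv_starRatio hz, mul_deriv_deriv_extremal_div c hz]
  have hpos := he.re_starRatio_pos hc2
  have hre := re_neg_log_deriv_pos hc he.differentiableOn_starRatio he.starRatio_zero hpos hode
  obtain ⟨w, hw, hwf⟩ := hf.exists_schwarz hc
  obtain ⟨ω, hω, hmaps, hω0, hcomp⟩ := exists_subordination hc hf.differentiableOn_starRatio
    he.differentiableOn_starRatio hf.starRatio_zero he.starRatio_zero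
    (injOn_of_re_neg_log_deriv_pos he.differentiableOn_starRatio hpos hre) hre hw
    (fun z hz => by rw [hf.mul_deriv_starRatio hz, hwf z hz]) hode
  exact ⟨ω, hω, hmaps, hω0, fun z hz => by rw [hcomp z hz, psi_eq_inv_starRatio hc]⟩

/-! ### Taylor and logarithmic coefficients -/

theorem taylorCoeff_zero (F : ℂ → ℂ) : taylorCoeff F 0 = F 0 := by
  simp [taylorCoeff]

theorem taylorCoeff_congr {F G : ℂ → ℂ} (h : F =ᶠ[𝓝 0] G) (n : ℕ) :
    taylorCoeff F n = taylorCoeff G n := by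
  rw [taylorCoeff, taylorCoeff, h.iteratedDeriv_eq]

theorem taylorCoeff_deriv (F : ℂ → ℂ) (n : ℕ) :
    taylorCoeff (deriv F) n = (n + 1) * taylorCoeff F (n + 1) := by
  rw [taylorCoeff, taylorCoeff, iteratedDeriv_succ', Nat.factorial_succ]
  have : (n.factorial : ℂ) ≠ 0 := by exact_mod_cast n.factorial_ne_zero
  have : (n : ℂ) + 1 ≠ 0 := by exact_mod_cast n.succ_ne_zero
  push_cast
  field_simp

theorem taylorCoeff_dslope {F : ℂ → ℂ} (hF : AnalyticAt ℂ F 0) (n : ℕ) :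
    taylorCoeff (dslope F 0) n = taylorCoeff F (n + 1) := by
  have h1 := hF.hasFPowerSeriesAt
  have h2 := h1.has_fpower_series_dslope_fslope
  have h3 := AnalyticAt.hasFPowerSeriesAt ⟨_, h2⟩
  have h4 := congrArg (fun p => p.coeff n) (h3.eq_formalMultilinearSeries h2)
  simpa [FormalMultilinearSeries.coeff_fslope, taylorCoeff] using h4

/-- Relation between the coefficients of `z f'(z) / f(z)` and the logarithmic coefficients. -/
theorem ClassF.taylorCoeff_inv_starRatio {c : ℝ} {f : ℂ → ℂ} (hf : ClassF c f) (n : ℕ) :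
    taylorCoeff (fun z => (starRatio f z)⁻¹) (n + 1) = 2 * (n + 1) * logCoeff f (n + 1) := by
  have h0 := unitDisk_mem_nhds zero_mem_unitDisk
  have hg : (fun z => if z = 0 then 1 else f z / z) = dslope f 0 := by
    funext z
    split_ifs with h
    · rw [h, dslope_same, hf.deriv_zero]
    · rw [dslope_of_ne f h, slope_def_field, hf.map_zero, sub_zero, sub_zero]
  have hgan : AnalyticAt ℂ (dslope f 0) 0 :=
    (differentiableOn_dslope_unitDisk hf.analytic).analyticAt h0
  have hg0 : dslope f 0 0 = 1 := by rw [dslope_same, hf.deriv_zero]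
  set l : ℂ → ℂ := fun z => Complex.log (dslope f 0 z) with hl
  have hlan : AnalyticAt ℂ l 0 := hgan.clog (by rw [hg0]; simp)
  have hpan : AnalyticAt ℂ (fun z => (starRatio f z)⁻¹) 0 :=
    (hf.differentiableOn_starRatio.analyticAt h0).inv (by rw [hf.starRatio_zero]; simp)
  have hdan : AnalyticAt ℂ (dslope (fun z => (starRatio f z)⁻¹) 0) 0 :=
    ⟨_, hpan.hasFPowerSeriesAt.has_fpower_series_dslope_fslope⟩
  have hslit : ∀ᶠ z in 𝓝 (0 : ℂ), dslope f 0 z ∈ Complex.slitPlane :=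
    hgan.continuousAt.eventually
      (Complex.isOpen_slitPlane.mem_nhds (by rw [hg0]; simp))
  -- This is `z f' / f = 1 + z (log (f / z))'`, divided by `z`; it is checked off the origin and
  -- extended by the identity principle.
  have heq : dslope (fun z => (starRatio f z)⁻¹) 0 =ᶠ[𝓝 0] deriv l := by
    refine (AnalyticAt.frequently_eq_iff_eventually_eq hdan hlan.deriv).1
      (Eventually.frequently ?_)
    filter_upwards [self_mem_nhdsWithin, nhdsWithin_le_nhds hslit, nhdsWithin_le_nhds h0]
      with z hz hzs hzD
    have hz0 : z ≠ 0 := hz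
    have hgd := ((differentiableOn_dslope_unitDisk hf.analytic).differentiableAt
      (unitDisk_mem_nhds hzD)).hasDerivAt
    have hld : deriv l z = deriv (dslope f 0) z / dslope f 0 z := (hgd.clog hzs).deriv
    have h2 := hf.dslope_add_mul_deriv_dslope hzD
    have hne : dslope f 0 z ≠ 0 := Complex.slitPlane_ne_zero hzs
    rw [hld, dslope_of_ne _ hz0, slope_def_field, hf.starRatio_zero, starRatio, ← h2]
    field_simp
    ring
  rw [← taylorCoeff_dslope hpan, taylorCoeff_congr heq, taylorCoeff_deriv, logCoeff]
  have : (fun z => Complex.log (if z = 0 then 1 else f z / z)) = l := by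
    funext z; rw [hl, ← hg]
  rw [this]
  ring

/-! ### Rogosinski's theorem -/

/-- Orthogonality in the mean of a constant and a holomorphic function vanishing at the origin. -/
theorem circleAverage_normSq_const_add {F : ℂ → ℂ} (hF : DifferentiableOn ℂ F unitDisk)
    (hF0 : F 0 = 0) (a : ℂ) {r : ℝ} (hr : 0 < r) (hr1 : r < 1) :
    circleAverage (fun z => ‖a + F z‖ ^ 2) 0 r =
      ‖a‖ ^ 2 + circleAverage (fun z => ‖F z‖ ^ 2) 0 r := by
  have hcont : ContinuousOn F (sphere 0 r) :=
    hF.continuousOn.mono (sphere_subset_closedBall.trans (closedBall_subset_ball hr1))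
  have hdc : DiffContOnCl ℂ (fun z => starRingEnd ℂ a * F z) (ball 0 |r|) := by
    rw [abs_of_pos hr]
    refine DifferentiableOn.diffContOnCl ?_
    rw [closure_ball _ hr.ne']
    exact (hF.mono (closedBall_subset_ball hr1)).const_mul _
  have hmean := hdc.circleAverage
  have hint : CircleIntegrable (fun z => starRingEnd ℂ a * F z) 0 r :=
    (continuousOn_const.mul hcont).circleIntegrable hr.le
  have hre := Complex.reCLM.circleAverage_comp_comm hint
  rw [hmean] at hre
  have hexp : (fun z => ‖a + F z‖ ^ 2) = fun z => (‖a‖ ^ 2 + ‖F z‖ ^ 2) +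
      (2 : ℝ) • (Complex.reCLM ∘ fun z => starRingEnd ℂ a * F z) z := by
    funext z
    simp only [← Complex.normSq_eq_norm_sq, Complex.normSq_apply]
    simp
    ring
  have i1 : CircleIntegrable (fun z => ‖F z‖ ^ 2) 0 r :=
    (hcont.norm.pow 2).circleIntegrable hr.le
  have i2 : CircleIntegrable (fun _ : ℂ => ‖a‖ ^ 2) 0 r :=
    continuousOn_const.circleIntegrable hr.le
  have i3 : CircleIntegrable (fun z => ‖a‖ ^ 2 + ‖F z‖ ^ 2) 0 r := i2.add i1
  have i4 : CircleIntegrable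
      (fun z => (2 : ℝ) • (Complex.reCLM ∘ fun z => starRingEnd ℂ a * F z) z) 0 r :=
    ((Complex.reCLM.continuous.comp_continuousOn
      (continuousOn_const.mul hcont)).const_smul (2 : ℝ)).circleIntegrable hr.le
  rw [hexp, circleAverage_fun_add i3 i4, circleAverage_fun_smul, hre,
    circleAverage_fun_add i2 i1, circleAverage_const]
  simp [hF0]

/-- Littlewood's subordination inequality for polynomials. -/
theorem circleAverage_polynomial_comp_le {ω : ℂ → ℂ} (hω : DifferentiableOn ℂ ω unitDisk)
    (hmaps : MapsTo ω unitDisk unitDisk) (hω0 : ω 0 = 0) {r : ℝ} (hr : 0 < r) (hr1 : r < 1)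
    (N : ℕ) (d : ℕ → ℂ) :
    circleAverage (fun z => ‖∑ k ∈ Finset.range N, d k * ω z ^ k‖ ^ 2) 0 r ≤
      ∑ k ∈ Finset.range N, ‖d k‖ ^ 2 := by
  induction N generalizing d with
  | zero => simp [circleAverage_const]
  | succ N ih =>
    have hsub : sphere (0 : ℂ) r ⊆ unitDisk :=
      sphere_subset_closedBall.trans (closedBall_subset_ball hr1)
    -- Split off the constant term, which is orthogonal to `ω T`, then drop the factor `|ω| < 1` and
    -- induct on `T`.
    set T : ℂ → ℂ := fun z => ∑ k ∈ Finset.range N, d (k + 1) * ω z ^ k with hT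
    have hTd : DifferentiableOn ℂ T unitDisk :=
      DifferentiableOn.fun_sum fun k _ => (hω.pow k).const_mul _
    have hsplit : (fun z => ‖∑ k ∈ Finset.range (N + 1), d k * ω z ^ k‖ ^ 2) =
        fun z => ‖d 0 + ω z * T z‖ ^ 2 := by
      funext z
      rw [Finset.sum_range_succ', hT, Finset.mul_sum, add_comm]
      simp only [pow_zero, mul_one]
      congr 3
      exact Finset.sum_congr rfl fun k _ => by ring
    rw [hsplit, circleAverage_normSq_const_add (F := fun z => ω z * T z) (hω.mul hTd)
      (by simp [hω0]) _ hr hr1,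
      Finset.sum_range_succ', add_comm]
    gcongr
    refine le_trans (circleAverage_mono ?_ ?_ fun z hz => ?_) (ih fun k => d (k + 1))
    · exact ((((hω.mul hTd).continuousOn.mono hsub).norm).pow 2).circleIntegrable hr.le
    · exact (((hTd.continuousOn.mono hsub).norm).pow 2).circleIntegrable hr.le
    · rw [abs_of_pos hr] at hz
      have h1 : ‖ω z‖ < 1 := by simpa using hmaps (hsub hz)
      rw [norm_mul]
      have : ‖ω z‖ * ‖T z‖ ≤ ‖T z‖ := mul_le_of_le_one_left (norm_nonneg _) h1.le
      gcongr

/-- Bessel's inequality for the first `N` Taylor coefficients of a holomorphic function which is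
modified from order `N` on. -/
theorem sum_taylorCoeff_le_circleAverage {r : ℝ} (hr : 0 < r) (hr1 : r < 1) {E : ℂ → ℂ}
    (hE : DifferentiableOn ℂ E unitDisk) (N : ℕ) {F : ℂ → ℂ} (hF : DifferentiableOn ℂ F unitDisk) :
    ∑ k ∈ Finset.range N, ‖taylorCoeff F k‖ ^ 2 * r ^ (2 * k) ≤
      circleAverage (fun z => ‖F z - z ^ N * E z‖ ^ 2) 0 r := by
  induction N generalizing F with
  | zero =>
    simp only [Finset.range_zero, Finset.sum_empty]
    exact circleAverage_nonneg_of_nonneg fun z _ => by positivity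
  | succ N ih =>
    have hF1 := differentiableOn_dslope_unitDisk hF
    have han : AnalyticAt ℂ F 0 := hF.analyticAt (unitDisk_mem_nhds zero_mem_unitDisk)
    have hK : DifferentiableOn ℂ (fun z => dslope F 0 z - z ^ N * E z) unitDisk :=
      hF1.sub ((differentiableOn_id.pow N).mul hE)
    have hsplit : (fun z => ‖F z - z ^ (N + 1) * E z‖ ^ 2) =
        fun z => ‖F 0 + z * (dslope F 0 z - z ^ N * E z)‖ ^ 2 := by
      funext z
      have := mul_dslope_zero F z
      congr 2
      linear_combination -this
    have hscale : circleAverage (fun z => ‖z * (dslope F 0 z - z ^ N * E z)‖ ^ 2) 0 r =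
        r ^ 2 • circleAverage (fun z => ‖dslope F 0 z - z ^ N * E z‖ ^ 2) 0 r := by
      rw [← circleAverage_fun_smul]
      refine circleAverage_congr_sphere fun z hz => ?_
      rw [abs_of_pos hr, mem_sphere_zero_iff_norm] at hz
      simp only [norm_mul, hz, smul_eq_mul]
      ring
    rw [hsplit, circleAverage_normSq_const_add
      (F := fun z => z * (dslope F 0 z - z ^ N * E z)) (differentiableOn_id.mul hK)
      (by simp) _ hr hr1,
      Finset.sum_range_succ', add_comm]
    refine add_le_add (by simp [taylorCoeff_zero]) ?_
    refine le_trans ?_ hscale.ge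
    refine le_trans (le_of_eq ?_) (smul_le_smul_of_nonneg_left (ih hF1) (by positivity))
    rw [smul_eq_mul, Finset.mul_sum]
    refine Finset.sum_congr rfl fun k _ => ?_
    rw [taylorCoeff_dslope han]
    ring

/-- Taylor's formula with holomorphic remainder. -/
theorem exists_eq_sum_add_pow_mul (N : ℕ) {q : ℂ → ℂ} (hq : DifferentiableOn ℂ q unitDisk) :
    ∃ E : ℂ → ℂ, DifferentiableOn ℂ E unitDisk ∧
      ∀ w, q w = ∑ k ∈ Finset.range N, taylorCoeff q k * w ^ k + w ^ N * E w := by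
  induction N generalizing q with
  | zero => exact ⟨q, hq, by simp⟩
  | succ N ih =>
    obtain ⟨E, hE, h⟩ := ih (differentiableOn_dslope_unitDisk hq)
    have han : AnalyticAt ℂ q 0 := hq.analyticAt (unitDisk_mem_nhds zero_mem_unitDisk)
    refine ⟨E, hE, fun w => ?_⟩
    have h1 := mul_dslope_zero q w
    rw [h w] at h1
    rw [Finset.sum_range_succ', taylorCoeff_zero, pow_zero, mul_one]
    have h2 : ∑ k ∈ Finset.range N, taylorCoeff q (k + 1) * w ^ (k + 1) =
        w * ∑ k ∈ Finset.range N, taylorCoeff (dslope q 0) k * w ^ k := by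
      rw [Finset.mul_sum]
      refine Finset.sum_congr rfl fun k _ => ?_
      rw [taylorCoeff_dslope han]
      ring
    rw [h2]
    linear_combination -h1

/-- **Rogosinski's theorem** on the coefficients of subordinate functions. -/
theorem sum_normSq_taylorCoeff_comp_le {p q ω : ℂ → ℂ} (hq : DifferentiableOn ℂ q unitDisk)
    (hp : DifferentiableOn ℂ p unitDisk)
    (hω : DifferentiableOn ℂ ω unitDisk) (hmaps : MapsTo ω unitDisk unitDisk) (hω0 : ω 0 = 0)
    (hpq : ∀ z ∈ unitDisk, p z = q (ω z)) (N : ℕ) :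
    ∑ k ∈ Finset.range N, ‖taylorCoeff p k‖ ^ 2 ≤
      ∑ k ∈ Finset.range N, ‖taylorCoeff q k‖ ^ 2 := by
  obtain ⟨E, hE, hqE⟩ := exists_eq_sum_add_pow_mul N hq
  have hbound : ∀ r : ℝ, 0 < r → r < 1 →
      ∑ k ∈ Finset.range N, ‖taylorCoeff p k‖ ^ 2 * r ^ (2 * k) ≤
        ∑ k ∈ Finset.range N, ‖taylorCoeff q k‖ ^ 2 := by
    intro r hr hr1
    -- With `ω = z · dslope ω 0`, the remainder `ω^N E(ω)` is `z^N` times a holomorphic function, so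
    -- subtracting it from `p` leaves a polynomial in `ω` without changing the first `N`
    -- coefficients.
    have hE' : DifferentiableOn ℂ (fun z => dslope ω 0 z ^ N * E (ω z)) unitDisk :=
      ((differentiableOn_dslope_unitDisk hω).pow N).mul (hE.comp hω hmaps)
    refine (sum_taylorCoeff_le_circleAverage hr hr1 hE' N hp).trans (le_trans (le_of_eq ?_)
      (circleAverage_polynomial_comp_le hω hmaps hω0 hr hr1 N (taylorCoeff q)))
    refine circleAverage_congr_sphere fun z hz => ?_
    rw [abs_of_pos hr, mem_sphere_zero_iff_norm] at hz
    have hzD : z ∈ unitDisk := by simpa [hz] using hr1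
    have h1 : z * dslope ω 0 z = ω z := by rw [mul_dslope_zero, hω0, sub_zero]
    have h2 := hqE (ω z)
    rw [hpq z hzD, h2, ← mul_assoc, ← mul_pow, h1, add_sub_cancel_right]
  have hlim : Tendsto (fun r : ℝ => ∑ k ∈ Finset.range N, ‖taylorCoeff p k‖ ^ 2 * r ^ (2 * k))
      (𝓝[<] 1) (𝓝 (∑ k ∈ Finset.range N, ‖taylorCoeff p k‖ ^ 2 * 1 ^ (2 * k))) :=
    Continuous.tendsto' (by fun_prop) 1 _ rfl |>.mono_left nhdsWithin_le_nhds
  simp only [one_pow, mul_one] at hlim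
  refine le_of_tendsto hlim ?_
  filter_upwards [Ioo_mem_nhdsLT (zero_lt_one : (0 : ℝ) < 1)] with r hr
  exact hbound r hr.1 hr.2

/-! ### Weights and the coefficient inequalities -/

/-- Domination of partial sums is preserved by antitone nonnegative weights. -/
theorem sum_weight_mul_le {a b w : ℕ → ℝ} (hw : Antitone w) (hw0 : ∀ n, 0 ≤ w n)
    (hab : ∀ N, ∑ k ∈ Finset.range N, a k ≤ ∑ k ∈ Finset.range N, b k) (N : ℕ) :
    ∑ k ∈ Finset.range N, w k * a k ≤ ∑ k ∈ Finset.range N, w k * b k := by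
  -- Abel summation as an induction: the boundary term `w N (B_N - A_N)` is kept so that the step
  -- closes.
  have key : ∀ N, w N * (∑ k ∈ Finset.range N, b k - ∑ k ∈ Finset.range N, a k) ≤
      ∑ k ∈ Finset.range N, w k * b k - ∑ k ∈ Finset.range N, w k * a k := by
    intro N
    induction N with
    | zero => simp
    | succ N ih =>
      have h1 := mul_le_mul_of_nonneg_right (hw N.le_succ) (sub_nonneg.2 (hab (N + 1)))
      refine h1.trans ?_
      simp only [Finset.sum_range_succ]
      linarith
  have := mul_nonneg (hw0 N) (sub_nonneg.2 (hab N))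
  linarith [key N]

theorem tsum_ofReal_weight_mul_le {a b w : ℕ → ℝ} (hw : Antitone w) (hw0 : ∀ n, 0 ≤ w n)
    (ha : ∀ n, 0 ≤ a n) (hb : ∀ n, 0 ≤ b n)
    (hab : ∀ N, ∑ k ∈ Finset.range N, a k ≤ ∑ k ∈ Finset.range N, b k) :
    ∑' n, ENNReal.ofReal (w n * a n) ≤ ∑' n, ENNReal.ofReal (w n * b n) := by
  rw [ENNReal.tsum_eq_iSup_nat]
  refine iSup_le fun N => le_trans ?_ (ENNReal.sum_le_tsum (Finset.range N))
  rw [← ENNReal.ofReal_sum_of_nonneg fun n _ => mul_nonneg (hw0 n) (ha n),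
    ← ENNReal.ofReal_sum_of_nonneg fun n _ => mul_nonneg (hw0 n) (hb n)]
  exact ENNReal.ofReal_le_ofReal (sum_weight_mul_le hw hw0 hab N)

/-- With `m = n + 1`, the weight factors as `(m + 1)^(t - 2) (1 + 1/m)²`, and both factors decrease
when `t ≤ 2`. -/
theorem antitone_rpow_div_sq {t : ℝ} (ht : t ≤ 2) :
    Antitone fun n : ℕ => (((n + 1 : ℕ) : ℝ) + 1) ^ t / ((n + 1 : ℕ) : ℝ) ^ 2 := by
  have h : (fun n : ℕ => (((n + 1 : ℕ) : ℝ) + 1) ^ t / ((n + 1 : ℕ) : ℝ) ^ 2) =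
      fun n : ℕ => (((n + 1 : ℕ) : ℝ) + 1) ^ (t - 2) * (1 + 1 / ((n + 1 : ℕ) : ℝ)) ^ 2 := by
    funext n
    have h1 : (0 : ℝ) < ((n + 1 : ℕ) : ℝ) + 1 := by positivity
    have h2 : (0 : ℝ) < ((n + 1 : ℕ) : ℝ) := by positivity
    rw [rpow_sub h1, rpow_two]
    field_simp
  rw [h]
  intro m n hmn
  have hmn' : ((m + 1 : ℕ) : ℝ) ≤ ((n + 1 : ℕ) : ℝ) := by exact_mod_cast Nat.succ_le_succ hmn
  have hm : (0 : ℝ) < ((m + 1 : ℕ) : ℝ) := by positivity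
  refine mul_le_mul ?_ ?_ (by positivity) (by positivity)
  · exact rpow_le_rpow_of_nonpos (by positivity) (by linarith) (by linarith)
  · gcongr

/-- Both functions equal `1` at the origin, so the constant terms cancel from Rogosinski's
inequality. -/
theorem ClassF.sum_normSq_taylorCoeff_le {c : ℝ} (hc : 0 < c) (hc2 : c ≤ 2) {f : ℂ → ℂ}
    (hf : ClassF c f) (N : ℕ) :
    ∑ k ∈ Finset.range N, ‖taylorCoeff (fun z => (starRatio f z)⁻¹) (k + 1)‖ ^ 2 ≤
      ∑ k ∈ Finset.range N, ‖taylorCoeff (psi c) (k + 1)‖ ^ 2 := by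
  obtain ⟨ω, hω, hmaps, hω0, hcomp⟩ := hf.exists_inv_starRatio_eq_psi_comp hc hc2
  have he := classF_extremal hc
  have hpsi : DifferentiableOn ℂ (psi c) unitDisk :=
    (he.differentiableOn_starRatio.inv fun _ hz => he.starRatio_ne_zero hc2 hz).congr
      fun z _ => psi_eq_inv_starRatio hc z
  have h := sum_normSq_taylorCoeff_comp_le hpsi
    (hf.differentiableOn_starRatio.inv fun _ hz => hf.starRatio_ne_zero hc2 hz)
    hω hmaps hω0 hcomp (N + 1)
  rw [Finset.sum_range_succ', Finset.sum_range_succ', taylorCoeff_zero, taylorCoeff_zero] at h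
  have h0 : ((starRatio f)⁻¹) 0 = psi c 0 := by
    simp [hf.starRatio_zero, psi]
  rw [h0] at h
  exact le_of_add_le_add_right h

theorem ClassF.sq_mul_normSq_logCoeff {c : ℝ} {f : ℂ → ℂ} (hf : ClassF c f) (n : ℕ) :
    ((n + 1 : ℕ) : ℝ) ^ 2 * ‖logCoeff f (n + 1)‖ ^ 2 =
      1 / 4 * ‖taylorCoeff (fun z => (starRatio f z)⁻¹) (n + 1)‖ ^ 2 := by
  have h : ‖(n : ℂ) + 1‖ = n + 1 := by
    rw [← Nat.cast_succ, Complex.norm_natCast, Nat.cast_succ]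
  rw [hf.taylorCoeff_inv_starRatio, norm_mul, norm_mul, h]
  push_cast
  simp
  ring

/-- Common form of both inequalities. Monotonicity is asked only from index `1` on, because `(n +
1)^t / n²` takes the default value `0` at `n = 0`. -/
theorem ClassF.tsum_weight_mul_normSq_logCoeff_le {c : ℝ} (hc : 0 < c) (hc2 : c ≤ 2) {f : ℂ → ℂ}
    (hf : ClassF c f) {w : ℕ → ℝ} (hw : Antitone fun n => w (n + 1)) (hw0 : ∀ n, 0 ≤ w n) :
    ∑' n : ℕ+, ENNReal.ofReal (w n * ((n : ℝ) ^ 2 * ‖logCoeff f n‖ ^ 2)) ≤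
      (1 / 4) * ∑' n : ℕ+, ENNReal.ofReal (w n * ‖taylorCoeff (psi c) n‖ ^ 2) := by
  rw [tsum_pnat_eq_tsum_succ
      (f := fun n : ℕ => ENNReal.ofReal (w n * ((n : ℝ) ^ 2 * ‖logCoeff f n‖ ^ 2))),
    tsum_pnat_eq_tsum_succ
      (f := fun n : ℕ => ENNReal.ofReal (w n * ‖taylorCoeff (psi c) n‖ ^ 2)),
    ← ENNReal.tsum_mul_left]
  have hquarter : (1 / 4 : ENNReal) = ENNReal.ofReal (1 / 4) := by
    rw [ENNReal.ofReal_div_of_pos (by norm_num)]; simp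
  have h := tsum_ofReal_weight_mul_le hw (fun n => hw0 (n + 1))
    (a := fun n => 1 / 4 * ‖taylorCoeff (fun z => (starRatio f z)⁻¹) (n + 1)‖ ^ 2)
    (b := fun n => 1 / 4 * ‖taylorCoeff (psi c) (n + 1)‖ ^ 2)
    (fun n => by positivity) (fun n => by positivity) (fun N => by
      rw [← Finset.mul_sum, ← Finset.mul_sum]
      exact mul_le_mul_of_nonneg_left (hf.sum_normSq_taylorCoeff_le hc hc2 N) (by norm_num))
  refine le_trans (le_of_eq (tsum_congr fun n => ?_))
    (h.trans (le_of_eq (tsum_congr fun n => ?_)))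
  · rw [hf.sq_mul_normSq_logCoeff]
  · rw [hquarter, ← ENNReal.ofReal_mul (by norm_num)]
    congr 1
    ring

end LogCoeffs

theorem mainTheorem1 (c : ℝ) (hc : c ∈ Set.Ioc (0 : ℝ) 2) :
    (∀ f : ℂ → ℂ, LogCoeffs.ClassF c f →
      (∑' n : ℕ+, ENNReal.ofReal ((n : ℝ) ^ 2 * ‖LogCoeffs.logCoeff f n‖ ^ 2) ≤
        (1 / 4) * ∑' n : ℕ+, ENNReal.ofReal
          (‖LogCoeffs.taylorCoeff (LogCoeffs.psi c) n‖ ^ 2)) ∧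
      (∀ t : ℝ, t ≤ 2 →
        ∑' n : ℕ+, ENNReal.ofReal (((n : ℝ) + 1) ^ t * ‖LogCoeffs.logCoeff f n‖ ^ 2) ≤
          (1 / 4) * ∑' n : ℕ+, ENNReal.ofReal
            (((n : ℝ) + 1) ^ t / (n : ℝ) ^ 2 *
              ‖LogCoeffs.taylorCoeff (LogCoeffs.psi c) n‖ ^ 2))) ∧
    LogCoeffs.ClassF c (LogCoeffs.extremal c) ∧
    ∑' n : ℕ+, ENNReal.ofReal
        ((n : ℝ) ^ 2 * ‖LogCoeffs.logCoeff (LogCoeffs.extremal c) n‖ ^ 2) =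
      (1 / 4) * ∑' n : ℕ+, ENNReal.ofReal
        (‖LogCoeffs.taylorCoeff (LogCoeffs.psi c) n‖ ^ 2) := by
  have he := LogCoeffs.classF_extremal hc.1
  refine ⟨fun f hf => ⟨?_, fun t ht => ?_⟩, he, ?_⟩
  · simpa using hf.tsum_weight_mul_normSq_logCoeff_le hc.1 hc.2 (w := fun _ => 1)
      antitone_const (fun _ => zero_le_one)
  · have h := hf.tsum_weight_mul_normSq_logCoeff_le hc.1 hc.2
      (w := fun n => ((n : ℝ) + 1) ^ t / (n : ℝ) ^ 2)
      (LogCoeffs.antitone_rpow_div_sq ht) (fun n => by positivity)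
    refine le_trans (le_of_eq (tsum_congr fun n => ?_)) h
    have hn : (n : ℝ) ≠ 0 := by exact_mod_cast n.ne_zero
    congr 1
    field_simp
  -- For `f = f_c` the function `z f' / f` is `ψ` itself, so equality holds term by term.
  · rw [← ENNReal.tsum_mul_left]
    refine tsum_congr fun n => ?_
    have hquarter : (1 / 4 : ENNReal) = ENNReal.ofReal (1 / 4) := by
      rw [ENNReal.ofReal_div_of_pos (by norm_num)]; simp
    have hpsi : LogCoeffs.psi c = fun z => (LogCoeffs.starRatio (LogCoeffs.extremal c) z)⁻¹ :=
      funext fun z => LogCoeffs.psi_eq_inv_starRatio hc.1 z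
    have h := he.sq_mul_normSq_logCoeff n.natPred
    rw [PNat.natPred_add_one] at h
    rw [hquarter, ← ENNReal.ofReal_mul (by norm_num), h, hpsi]
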